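/- Let $\mathbb K$ be an algebraically closed field with a rank one non-archimedean valuation $\mathrm{val}:\mathbb K^*\to\mathbb R$ such that both $\mathbb K$ and its residue field $K$ have characteristic zero. Let $v\mapsto t^v$ be a splitting of the valuation, i.e. a group homomorphism from the value group $\mathrm{val}(\mathbb K^*)$ to $\mathbb K^*$ with $\mathrm{val}(t^v)=v$. For $c\in\mathbb K^*$ and $\gamma\in K^*$ write $c=\gamma t^v+*$ if $\mathrm{val}(c)=v$ and $\gamma$ is the residue class of $c\,t^{-v}$. Let $n\ge 4$. Identify $c=(c_0,\dots,c_n)\in\mathbb K^{n+1}$ with the polynomial $\sum_{i=0}^n c_ix^i$, and let $Sev_n^2\subseteq\mathbb K^{n+1}$ be the Zariski closure of the set of polynomials $l\,(x-a)^2(x-b)^2\prod_{i=1}^{n-4}(x-r_i)$ with $l,a,b,r_1,\dots,r_{n-4}\in\mathbb K^*$ and $a,b,r_1,\dots,r_{n-4}$ pairwise different. Its tropicalization $\mathcal T(Sev_n^2)\subseteq\mathbb R^{n+1}$ is the set of all $w$ such that, for every nonzero Laurent polynomial $g=\sum_\alpha g_\alpha x^\alpha$ over $\mathbb K$ in $n+1$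 variables that vanishes on $Sev_n^2\cap(\mathbb K^*)^{n+1}$, the minimum of $\mathrm{val}(g_\alpha)+\langle w,\alpha\rangle$ over all $\alpha$ with $g_\alpha\ne0$ is attained at least twice. For $w\in\mathbb R^{n+1}$ let $\mathbb K[x]_w$ be the set of polynomials $\sum_{i=0}^n c_ix^i$ with all $c_i\neq 0$ and $\mathrm{val}(c_i)=w_i$ for $i=0,\dots,n$. The cells of the subdivision of $\{0,\dots,n\}$ induced by $w$ are the sets $\{j : (j,w_j)\in\Gamma\}$, where $\Gamma$ runs over the lower edges of the convex hull of $\{(0,w_0),\dots,(n,w_n)\}$. A cell is marked if it contains some $j$ for which $(j,w_j)$ lies in the relative interior of the corresponding edge. **Proposition.** Let $w\in\mathcal T(Sev_n^2)$ be such that the subdivision induced by $w$ has exactly one marked cell, and this cell is $\{i_1,i_2,i_3\}$ with $i_1<i_2<i_3$. Let $f\in Sev_n^2\cap\mathbb K[x]_w$, and let $a\neq b$ in $\mathbb K^*$ be two roots of $f$, each of multiplicity at least $2$, with the same valuation $v$, $a=\alpha t^v+*$ and $b=\beta t^v+*$. Then $\beta/\alpha\neq 1$, and $\beta/\alpha$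 is a root of unity whose order divides $\gcd(i_2-i_1,i_3-i_1)$. -/

import Mathlib

open Polynomial

noncomputable section

namespace TropSev

/-! ### Valued fields with a splitting of the valuation -/

section Valued

variable {𝕂 : Type*} [Field 𝕂]

/-- The valuation ring of an additive real valuation `val : 𝕂 → ℝ ∪ {∞}`. -/
abbrev valRing (val : AddValuation 𝕂 (WithTop ℝ)) : ValuationSubring 𝕂 :=
  (AddValuation.toValuation val).valuationSubring

/-- The residue field of the valuation. -/
abbrev ResField (val : AddValuation 𝕂 (WithTop ℝ)) : Type _ :=
  IsLocalRing.ResidueField (valRing val)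

/-- The value group `Γ = val(𝕂*)`, as an additive subgroup of `ℝ`. -/
def valueGroup (val : AddValuation 𝕂 (WithTop ℝ)) : AddSubgroup ℝ where
  carrier := {r | ∃ x : 𝕂, val x = (r : WithTop ℝ)}
  zero_mem' := ⟨1, by simp⟩
  add_mem' := by
    rintro r s ⟨x, hx⟩ ⟨y, hy⟩
    exact ⟨x * y, by simp [hx, hy]⟩
  neg_mem' := by
    rintro r ⟨x, hx⟩
    have hx0 : x ≠ 0 := by
      rintro rfl
      simp at hx
    refine ⟨x⁻¹, ?_⟩
    have h : val x + val x⁻¹ = 0 := by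
      rw [← AddValuation.map_mul, mul_inv_cancel₀ hx0, AddValuation.map_one]
    rw [hx] at h
    cases hv : val x⁻¹ with
    | top => simp [hv] at h
    | coe s =>
      rw [hv] at h
      norm_cast at h ⊢
      linarith

/-- A splitting `v ↦ t ^ v` of the valuation: a group homomorphism `Γ → 𝕂*` with
`val (t ^ v) = v`. -/
structure Splitting (val : AddValuation 𝕂 (WithTop ℝ)) where
  pow : Multiplicative (valueGroup val) →* 𝕂ˣ
  val_pow : ∀ v : valueGroup val,
    val (pow (Multiplicative.ofAdd v) : 𝕂) = ((v : ℝ) : WithTop ℝ)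

/-- `b = β t ^ v + *`: the element `b` has valuation `v`, and `β` is the residue class of
`b / t ^ v`. -/
def HasLeadingTerm {val : AddValuation 𝕂 (WithTop ℝ)} (t : Splitting val)
    (b : 𝕂) (β : ResField val) (v : valueGroup val) : Prop :=
  val b = ((v : ℝ) : WithTop ℝ) ∧
    ∃ u : valRing val, b = (u : 𝕂) * (t.pow (Multiplicative.ofAdd v) : 𝕂) ∧
      IsLocalRing.residue (valRing val) u = β

end Valued

/-! ### The Severi variety -/

section Severi

variable (𝕂 : Type*) [Field 𝕂]

variable {𝕂} in
/-- The coefficient vector `(c₀, …, cₙ)` of a polynomial. -/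
def coeffVec (n : ℕ) (f : 𝕂[X]) : Fin (n + 1) → 𝕂 := fun i => f.coeff i

/-- Coefficient vectors of the polynomials `l (x - a)² (x - b)² ∏ (x - rᵢ)` of degree `n`
(where `n ≥ 4`) with `l` and all the roots nonzero and with `a, b, r₁, …, rₙ₋₄` pairwise
different. -/
def severiImage (n : ℕ) : Set (Fin (n + 1) → 𝕂) :=
  {c | ∃ (a b l : 𝕂) (r : Fin (n - 4) → 𝕂),
    a ≠ 0 ∧ b ≠ 0 ∧ l ≠ 0 ∧ (∀ i, r i ≠ 0) ∧
    a ≠ b ∧ (∀ i, r i ≠ a ∧ r i ≠ b) ∧ Function.Injective r ∧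
    c = coeffVec n (C l * (X - C a) ^ 2 * (X - C b) ^ 2 * ∏ i, (X - C (r i)))}

/-- The Severi variety: the Zariski closure of `severiImage` in the affine space `𝕂ⁿ⁺¹`. -/
def severi (n : ℕ) : Set (Fin (n + 1) → 𝕂) :=
  MvPolynomial.zeroLocus 𝕂 (MvPolynomial.vanishingIdeal 𝕂 (severiImage 𝕂 n))

end Severi

/-! ### Tropicalization -/

section Tropical

variable {𝕂 : Type*} [Field 𝕂]

/-- Laurent polynomials in the variables indexed by `ι`. -/
abbrev Laurent (𝕂 : Type*) [Field 𝕂] (ι : Type*) : Type _ := AddMonoidAlgebra 𝕂 (ι → ℤ)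

/-- The value of a Laurent polynomial at a point (with nonzero coordinates). -/
def Laurent.eval {ι : Type*} [Fintype ι] (x : ι → 𝕂) (g : Laurent 𝕂 ι) : 𝕂 :=
  g.coeff.sum fun α γ => γ * ∏ i, x i ^ α i

/-- The term `val(g_α) + ⟨w, α⟩` of the tropical polynomial `trop(g)`. -/
def tropTerm (val : AddValuation 𝕂 (WithTop ℝ)) {ι : Type*} [Fintype ι]
    (g : Laurent 𝕂 ι) (w : ι → ℝ) (α : ι → ℤ) : WithTop ℝ :=
  val (g.coeff α) + ((∑ i, w i * (α i : ℝ) : ℝ) : WithTop ℝ)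

/-- `V(trop(g))`: the minimum of the terms of `trop(g)` at `w` is attained at least twice. -/
def tropHypersurface (val : AddValuation 𝕂 (WithTop ℝ)) {ι : Type*} [Fintype ι]
    (g : Laurent 𝕂 ι) : Set (ι → ℝ) :=
  {w | ∃ α ∈ g.coeff.support, ∃ β ∈ g.coeff.support, α ≠ β ∧
    tropTerm val g w α = tropTerm val g w β ∧
    ∀ γ ∈ g.coeff.support, tropTerm val g w α ≤ tropTerm val g w γ}

/-- The tropicalization of `X ⊆ 𝕂^ι`: the intersection of `V(trop(g))` over all nonzero Laurent
polynomials `g` in the ideal of `X ∩ (𝕂*)^ι`. -/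
def tropicalization (val : AddValuation 𝕂 (WithTop ℝ)) {ι : Type*} [Fintype ι]
    (X : Set (ι → 𝕂)) : Set (ι → ℝ) :=
  {w | ∀ g : Laurent 𝕂 ι, g ≠ 0 → (∀ x ∈ X, (∀ i, x i ≠ 0) → g.eval x = 0) →
    w ∈ tropHypersurface val g}

/-- `𝕂[x]_w`: the polynomials `∑_{i ≤ n} cᵢ xⁱ` with `val(cᵢ) = wᵢ` for all `i`. -/
def polysWithVal (val : AddValuation 𝕂 (WithTop ℝ)) {n : ℕ} (w : Fin (n + 1) → ℝ) :
    Set 𝕂[X] :=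
  {f | f.natDegree ≤ n ∧ ∀ i : Fin (n + 1), val (f.coeff i) = (w i : WithTop ℝ)}

end Tropical

/-! ### The marked regular subdivision of `{0, …, n}` -/

section Subdivision

variable {n : ℕ}

/-- The indices `j` for which `(j, w_j)` lies in the lower face of slope `s` of the convex hull of
`(0, w_0), …, (n, w_n)`, that is, where the linear functional `(x, y) ↦ y - s x` is minimal. -/
def lowerFace (w : Fin (n + 1) → ℝ) (s : ℝ) : Set (Fin (n + 1)) :=
  {j | ∀ k, w j - s * (j : ℕ) ≤ w k - s * (k : ℕ)}

/-- The cells of the subdivision induced by `w`: the index sets of the lower edges (the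
one-dimensional lower faces). -/
def IsCell (w : Fin (n + 1) → ℝ) (σ : Set (Fin (n + 1))) : Prop :=
  σ.Nontrivial ∧ ∃ s : ℝ, σ = lowerFace w s

/-- `j` is a marked point of the cell `σ`: the point `(j, w_j)` lies in the relative interior of
the edge, that is, it is an element of the cell strictly between two others. -/
def IsMarkedPoint (σ : Set (Fin (n + 1))) (j : Fin (n + 1)) : Prop :=
  j ∈ σ ∧ ∃ i ∈ σ, ∃ k ∈ σ, i < j ∧ j < k

/-- The marked cells of the subdivision induced by `w`: those with at least one marked point. -/
def markedCells (w : Fin (n + 1) → ℝ) : Set (Set (Fin (n + 1))) :=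
  {σ | IsCell w σ ∧ ∃ j, IsMarkedPoint σ j}

end Subdivision

end TropSev

end

open TropSev

namespace TropSev

/-! ### Multiple roots of polynomials with few terms. -/

section Fewnomial

variable {k : Type*} [Field k]

/-! Rescale `x` by `t^v`, divide by a term of least valuation and reduce: `f` becomes a nonzero `P`
over the residue field, supported on the lower face of slope `-v` and divisible by `(X - α)²(X -
β)²`, even if `α = β` (`exists_reduction`). In characteristic zero a nonzero root of multiplicity
`m` needs more than `m` terms (`lt_card_support_of_pow_dvd`). So the face has at least three points,
is the marked cell, and `P` is a trinomial; `α = β` would be a quadruple root, which is impossible.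
At a nonzero double root `r` of a trinomial, eliminating one term shows that `r^(i₂-i₁)` and
`r^(i₃-i₁)` are determined by `P`, so these powers of `β/α` are 1. -/

lemma coeff_X_mul_derivative_sub (P : k[X]) (i j : ℕ) :
    (X * derivative P - C (i : k) * P).coeff j = ((j : k) - i) * P.coeff j := by
  cases j with
  | zero => simp
  | succ j =>
    rw [coeff_sub, coeff_X_mul, coeff_C_mul, coeff_derivative]
    push_cast
    ring

/-- In characteristic zero, the multiplicity of a nonzero root of a polynomial is less than the
number of its terms. -/
lemma lt_card_support_of_pow_dvd [CharZero k] {r : k} (hr : r ≠ 0) (m : ℕ) :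
    ∀ P : k[X], P ≠ 0 → (X - C r) ^ m ∣ P → m < P.support.card := by
  induction m with
  | zero =>
    intro P hP _
    exact Finset.card_pos.2 (nonempty_support_iff.2 hP)
  | succ m ih =>
    intro P hP hdvd
    obtain ⟨i, hi⟩ := nonempty_support_iff.2 hP
    -- The Euler operator scales each monomial by its exponent, so `Q` loses the term `i` while the
    -- root loses at most one multiplicity.
    set Q : k[X] := X * derivative P - C (i : k) * P with hQ
    have hcoeff : ∀ j, Q.coeff j = ((j : k) - i) * P.coeff j := coeff_X_mul_derivative_sub P i
    have hsupp : Q.support ⊆ P.support.erase i := by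
      intro j hj
      rw [mem_support_iff, hcoeff] at hj
      rw [Finset.mem_erase, mem_support_iff]
      refine ⟨?_, right_ne_zero_of_mul hj⟩
      rintro rfl
      simp at hj
    have hQ0 : Q ≠ 0 := by
      intro h0
      have hmono : P = monomial i (P.coeff i) := by
        ext j
        rw [coeff_monomial]
        split_ifs with hij
        · rw [hij]
        · have h1 := hcoeff j
          rw [h0, coeff_zero] at h1
          rcases mul_eq_zero.1 h1.symm with h2 | h2
          · exact absurd (Nat.cast_injective (sub_eq_zero.1 h2)).symm hij
          · exact h2
      have hroot : P.eval r = 0 := by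
        rw [← IsRoot.def, ← dvd_iff_isRoot]
        exact (dvd_pow_self _ m.succ_ne_zero).trans hdvd
      rw [hmono, eval_monomial] at hroot
      exact mul_ne_zero (mem_support_iff.1 hi) (pow_ne_zero i hr) hroot
    have hQdvd : (X - C r) ^ m ∣ Q := by
      refine dvd_sub (Dvd.dvd.mul_left ?_ _) (Dvd.dvd.mul_left ?_ _)
      · simpa using pow_sub_one_dvd_derivative_of_pow_dvd hdvd
      · exact (pow_dvd_pow _ m.le_succ).trans hdvd
    have h1 := ih Q hQ0 hQdvd
    have h2 := Finset.card_le_card hsupp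
    rw [Finset.card_erase_of_mem hi] at h2
    omega

/-- The linear relation obtained from a double root of a trinomial by eliminating one term. -/
lemma trinomial_double_root {i j l : ℕ} (hij : i < j) (hjl : j < l) {P : k[X]}
    (hP : P.support = {i, j, l}) {r : k} (hr : (X - C r) ^ 2 ∣ P) (e : ℕ) :
    ((i : k) - e) * P.coeff i * r ^ i + ((j : k) - e) * P.coeff j * r ^ j +
      ((l : k) - e) * P.coeff l * r ^ l = 0 := by
  set Q : k[X] := X * derivative P - C (e : k) * P with hQ
  have hdvd : X - C r ∣ Q := by
    refine dvd_sub (Dvd.dvd.mul_left ?_ _) (Dvd.dvd.mul_left ?_ _)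
    · simpa using pow_sub_one_dvd_derivative_of_pow_dvd hr
    · exact (dvd_pow_self _ two_ne_zero).trans hr
  have hroot : Q.eval r = 0 := dvd_iff_isRoot.1 hdvd
  have hsupp : Q.support ⊆ {i, j, l} := by
    rw [← hP]
    intro m hm
    rw [mem_support_iff, coeff_X_mul_derivative_sub] at hm
    exact mem_support_iff.2 (right_ne_zero_of_mul hm)
  rw [eval_eq_sum, sum_def, Finset.sum_subset hsupp
    (fun m _ hm => by rw [notMem_support_iff.1 hm, zero_mul])] at hroot
  rw [Finset.sum_insert (by simp; omega), Finset.sum_insert (by simp; omega),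
    Finset.sum_singleton] at hroot
  simp only [hQ, coeff_X_mul_derivative_sub] at hroot
  linear_combination hroot

/-- Two nonzero double roots of a trinomial differ by a root of unity whose order divides the
differences of the exponents. -/
lemma div_pow_gcd_eq_one [CharZero k] {i j l : ℕ} (hij : i < j) (hjl : j < l) {P : k[X]}
    (hP : P.support = {i, j, l}) {r s : k} (hr0 : r ≠ 0) (hs0 : s ≠ 0)
    (hr : (X - C r) ^ 2 ∣ P) (hs : (X - C s) ^ 2 ∣ P) :
    (s / r) ^ Nat.gcd (j - i) (l - i) = 1 := by
  have hci : P.coeff i ≠ 0 := mem_support_iff.1 (by simp [hP])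
  have hcj : P.coeff j ≠ 0 := mem_support_iff.1 (by simp [hP])
  have hne : ∀ {m m' : ℕ}, m < m' → ((m : k) - m') ≠ 0 := fun h =>
    sub_ne_zero.2 (fun h' => h.ne (Nat.cast_injective h'))
  have key : ∀ {m m' : ℕ}, m ≤ m' → r ^ m * s ^ m' = s ^ m * r ^ m' →
      (s / r) ^ (m' - m) = 1 := by
    intro m m' hm h
    rw [div_pow, div_eq_one_iff_eq (pow_ne_zero _ hr0)]
    refine mul_left_cancel₀ (mul_ne_zero (pow_ne_zero m hr0) (pow_ne_zero m hs0)) ?_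
    calc r ^ m * s ^ m * s ^ (m' - m) = r ^ m * s ^ (m + (m' - m)) := by rw [pow_add]; ring
      _ = s ^ m * r ^ (m + (m' - m)) := by rw [Nat.add_sub_cancel' hm, h]
      _ = r ^ m * s ^ m * r ^ (m' - m) := by rw [pow_add]; ring
  have hl : r ^ i * s ^ l = s ^ i * r ^ l := by
    -- Taking `e = j` removes the middle term and leaves a relation between the `i`-th and `l`-th
    -- powers.
    have h1 := trinomial_double_root hij hjl hP hr j
    have h2 := trinomial_double_root hij hjl hP hs j
    have hcl : P.coeff l ≠ 0 := mem_support_iff.1 (by simp [hP])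
    refine mul_left_cancel₀ (mul_ne_zero (hne hjl) hcl) ?_
    linear_combination s ^ i * h1 - r ^ i * h2
  have hj : r ^ i * s ^ j = s ^ i * r ^ j := by
    have h1 := trinomial_double_root hij hjl hP hr l
    have h2 := trinomial_double_root hij hjl hP hs l
    refine mul_left_cancel₀ (mul_ne_zero (hne hjl) hcj) ?_
    linear_combination r ^ i * h2 - s ^ i * h1
  exact pow_gcd_eq_one.2 ⟨key hij.le hj, key (hij.trans hjl).le hl⟩

end Fewnomial

/-! ### Reduction to the residue field. -/

section Reduction

variable {𝕂 : Type*} [Field 𝕂] {val : AddValuation 𝕂 (WithTop ℝ)}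

lemma mem_valRing_iff {x : 𝕂} : x ∈ valRing val ↔ 0 ≤ val x := Iff.rfl

lemma residue_ne_zero_iff (u : valRing val) :
    IsLocalRing.residue (valRing val) u ≠ 0 ↔ val (u : 𝕂) = 0 := by
  rw [IsLocalRing.residue_ne_zero_iff_isUnit]
  exact (Valuation.integer.integers (AddValuation.toValuation val)).isUnit_iff_valuation_eq_one

lemma HasLeadingTerm.ne_zero {t : Splitting val} {b : 𝕂} {β : ResField val}
    {v : valueGroup val} (h : HasLeadingTerm t b β v) : β ≠ 0 := by
  obtain ⟨hv, u, hb, rfl⟩ := h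
  rw [residue_ne_zero_iff]
  rw [hb, AddValuation.map_mul, t.val_pow] at hv
  cases hu : val (u : 𝕂) with
  | top => simp [hu] at hv
  | coe s =>
    rw [hu] at hv
    norm_cast at hv ⊢
    linarith

/-- The reduction of a polynomial at valuation `v`: a polynomial over the residue field supported
on the lower face of slope `-v`, and divisible by the residues of the double roots. -/
lemma exists_reduction (t : Splitting val) {n : ℕ} (w : Fin (n + 1) → ℝ) {f : 𝕂[X]}
    (hfw : f ∈ polysWithVal val w) {a b : 𝕂} (hab : a ≠ b)
    (ha : 2 ≤ f.rootMultiplicity a) (hb : 2 ≤ f.rootMultiplicity b)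
    {α β : ResField val} {v : valueGroup val}
    (hα : HasLeadingTerm t a α v) (hβ : HasLeadingTerm t b β v) :
    ∃ P : (ResField val)[X], P ≠ 0 ∧ (X - C α) ^ 2 * (X - C β) ^ 2 ∣ P ∧
      ∀ m, m ∈ P.support ↔ ∃ j ∈ lowerFace w (-(v : ℝ)), (j : ℕ) = m := by
  obtain ⟨hdeg, hval⟩ := hfw
  obtain ⟨-, ua, rfl, rfl⟩ := hα
  obtain ⟨-, ub, rfl, rfl⟩ := hβ
  set T : 𝕂 := (t.pow (Multiplicative.ofAdd v) : 𝕂) with hT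
  have hT0 : T ≠ 0 := Units.ne_zero _
  have hTv : val T = ((v : ℝ) : WithTop ℝ) := t.val_pow v
  -- Dividing by the `k₀` term makes all rescaled coefficients integral, with residue nonzero
  -- exactly on the face.
  obtain ⟨k₀, hk₀⟩ := Finite.exists_min fun k : Fin (n + 1) => w k + v * (k : ℕ)
  have hterm : ∀ k : Fin (n + 1),
      val (f.coeff k * T ^ (k : ℕ)) = ((w k + v * (k : ℕ) : ℝ) : WithTop ℝ) := by
    intro k
    rw [AddValuation.map_mul, AddValuation.map_pow, hval, hTv, ← WithTop.coe_nsmul,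
      ← WithTop.coe_add, nsmul_eq_mul, mul_comm]
  set D : 𝕂 := f.coeff k₀ * T ^ (k₀ : ℕ) with hD
  have hD0 : D ≠ 0 := by
    intro h0
    have := hterm k₀
    rw [← hD, h0, AddValuation.map_zero] at this
    exact WithTop.top_ne_coe this
  have hquot : ∀ k : Fin (n + 1), val (f.coeff k * T ^ (k : ℕ) / D) =
      ((w k + v * (k : ℕ) - (w k₀ + v * (k₀ : ℕ)) : ℝ) : WithTop ℝ) := by
    intro k
    have h : val (f.coeff k * T ^ (k : ℕ) / D) + val D = val (f.coeff k * T ^ (k : ℕ)) := by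
      rw [← AddValuation.map_mul, div_mul_cancel₀ _ hD0]
    rw [hterm, hD, hterm] at h
    cases hu : val (f.coeff k * T ^ (k : ℕ) / D) with
    | top =>
      rw [← hD, hu, top_add] at h
      exact absurd h WithTop.top_ne_coe
    | coe s =>
      rw [← hD, hu] at h
      norm_cast at h ⊢
      linarith
  have hmem : ∀ m : ℕ, f.coeff m * T ^ m / D ∈ valRing val := by
    intro m
    rw [mem_valRing_iff]
    by_cases hm : m < n + 1
    · rw [hquot ⟨m, hm⟩]
      have := hk₀ ⟨m, hm⟩
      norm_cast
      linarith
    · rw [coeff_eq_zero_of_natDegree_lt (by omega)]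
      simp
  set h : (valRing val)[X] :=
    ∑ m ∈ Finset.range (n + 1), monomial m (⟨f.coeff m * T ^ m / D, hmem m⟩ : valRing val) with hh
  have hcoeff : ∀ m, h.coeff m = ⟨f.coeff m * T ^ m / D, hmem m⟩ := by
    intro m
    rw [hh, finsetSum_coeff]
    simp only [coeff_monomial]
    rw [Finset.sum_ite_eq']
    split_ifs with hm
    · rfl
    · ext
      rw [Finset.mem_range] at hm
      simp [coeff_eq_zero_of_natDegree_lt (show f.natDegree < m by omega)]
  have hmap : h.map (algebraMap (valRing val) 𝕂) = C D⁻¹ * f.comp (C T * X) := by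
    ext m
    rw [coeff_map, hcoeff, coeff_C_mul, comp_C_mul_X_coeff]
    change f.coeff m * T ^ m / D = _
    rw [div_eq_inv_mul]
  have hfdvd : (X - C ((ua : 𝕂) * T)) ^ 2 * (X - C ((ub : 𝕂) * T)) ^ 2 ∣ f := by
    refine IsCoprime.mul_dvd ?_ ?_ ?_
    · exact (isCoprime_X_sub_C_of_isUnit_sub (sub_ne_zero.2 hab).isUnit).pow
    · exact (pow_dvd_pow _ ha).trans (pow_rootMultiplicity_dvd f _)
    · exact (pow_dvd_pow _ hb).trans (pow_rootMultiplicity_dvd f _)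
  -- The two factors are coprime over `𝕂` but perhaps not modulo the maximal ideal. The product is
  -- monic, so its divisibility descends to the valuation ring and survives reduction.
  have hdvd : (X - C ua) ^ 2 * (X - C ub) ^ 2 ∣ h := by
    rw [← map_dvd_map (algebraMap (valRing val) 𝕂) Subtype.val_injective
      (((monic_X_sub_C ua).pow 2).mul ((monic_X_sub_C ub).pow 2)), hmap]
    refine Dvd.dvd.mul_left ?_ _
    obtain ⟨g, hg⟩ := hfdvd
    -- Each of the four linear factors contributes one `T`.
    refine ⟨C T ^ 4 * g.comp (C T * X), ?_⟩
    conv_lhs => rw [hg]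
    have e : ∀ u : valRing val, algebraMap (valRing val) 𝕂 u = (u : 𝕂) := fun _ => rfl
    simp only [mul_comp, pow_comp, sub_comp, X_comp, C_comp, Polynomial.map_mul,
      Polynomial.map_pow, Polynomial.map_sub, map_X, map_C, C_mul, e]
    ring
  have hsupp : ∀ m, m ∈ (h.map (IsLocalRing.residue (valRing val))).support ↔
      ∃ j ∈ lowerFace w (-(v : ℝ)), (j : ℕ) = m := by
    intro m
    rw [mem_support_iff, coeff_map, hcoeff, residue_ne_zero_iff]
    change val (f.coeff m * T ^ m / D) = 0 ↔ _
    constructor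
    · intro hm
      by_cases hmn : m < n + 1
      · refine ⟨⟨m, hmn⟩, fun k => ?_, rfl⟩
        rw [hquot ⟨m, hmn⟩] at hm
        norm_cast at hm
        have := hk₀ k
        linarith
      · rw [coeff_eq_zero_of_natDegree_lt (by omega)] at hm
        simp at hm
    · rintro ⟨j, hj, rfl⟩
      rw [hquot j]
      have h1 := hj k₀
      have h2 := hk₀ j
      norm_cast
      linarith
  refine ⟨h.map (IsLocalRing.residue (valRing val)), ?_, ?_, hsupp⟩
  · rw [← nonempty_support_iff]
    refine ⟨k₀, (hsupp k₀).2 ⟨k₀, fun k => ?_, rfl⟩⟩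
    have := hk₀ k
    linarith
  · simpa using Polynomial.map_dvd (IsLocalRing.residue (valRing val)) hdvd

end Reduction

/-- A finite set of indices with at least three elements has one strictly between two others. -/
lemma exists_isMarkedPoint {n : ℕ} {σ : Set (Fin (n + 1))} {s : Finset (Fin (n + 1))}
    (hs : ∀ j ∈ s, j ∈ σ) (hcard : 2 < s.card) : ∃ j, IsMarkedPoint σ j := by
  have hne : s.Nonempty := Finset.card_pos.1 (by omega)
  have h2 : ({s.min' hne, s.max' hne} : Finset (Fin (n + 1))).card < s.card :=
    Finset.card_le_two.trans_lt hcard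
  obtain ⟨j, hj, hj'⟩ := Finset.exists_mem_notMem_of_card_lt_card h2
  simp only [Finset.mem_insert, Finset.mem_singleton, not_or] at hj'
  exact ⟨j, hs j hj, _, hs _ (s.min'_mem hne), _, hs _ (s.max'_mem hne),
    lt_of_le_of_ne (s.min'_le j hj) (Ne.symm hj'.1), lt_of_le_of_ne (s.le_max' j hj) hj'.2⟩

end TropSev

/-! ### The marked cell and the conclusion. -/

theorem mainTheorem10 {𝕂 : Type*} [Field 𝕂] [IsAlgClosed 𝕂]
    (val : AddValuation 𝕂 (WithTop ℝ))
    (hrank : ∃ x : 𝕂, x ≠ 0 ∧ val x ≠ 0)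
    [CharZero 𝕂] [CharZero (ResField val)]
    (t : Splitting val)
    (n : ℕ) (hn : 4 ≤ n) (w : Fin (n + 1) → ℝ)
    (hw : w ∈ tropicalization val (severi 𝕂 n))
    (i₁ i₂ i₃ : Fin (n + 1)) (h₁₂ : i₁ < i₂) (h₂₃ : i₂ < i₃)
    (hmarked : markedCells w = {{i₁, i₂, i₃}})
    (f : 𝕂[X]) (hf : coeffVec n f ∈ severi 𝕂 n) (hfw : f ∈ polysWithVal val w)
    (a b : 𝕂) (hab : a ≠ b)
    (ha : 2 ≤ f.rootMultiplicity a) (hb : 2 ≤ f.rootMultiplicity b)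
    (α β : ResField val) (v : valueGroup val)
    (hα : HasLeadingTerm t a α v) (hβ : HasLeadingTerm t b β v) :
    β / α ≠ 1 ∧ IsOfFinOrder (β / α) ∧
      orderOf (β / α) ∣
        Nat.gcd ((i₂ : ℕ) - (i₁ : ℕ)) ((i₃ : ℕ) - (i₁ : ℕ)) := by
  obtain ⟨P, hP0, hdvd, hsupp⟩ := exists_reduction t w hfw hab ha hb hα hβ
  have hα0 := hα.ne_zero
  have hβ0 := hβ.ne_zero
  have hPα : (X - C α) ^ 2 ∣ P := (Dvd.intro _ rfl).trans hdvd
  have hPβ : (X - C β) ^ 2 ∣ P := (Dvd.intro_left _ rfl).trans hdvd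
  have hface : lowerFace w (-(v : ℝ)) = {i₁, i₂, i₃} := by
    classical
    set s : Finset (Fin (n + 1)) := Finset.univ.filter (· ∈ lowerFace w (-(v : ℝ))) with hs
    have hsP : P.support = s.map Fin.valEmbedding := by
      ext m
      rw [hsupp]
      simp [hs]
    have hcard : 2 < s.card := by
      rw [← Finset.card_map Fin.valEmbedding, ← hsP]
      exact lt_card_support_of_pow_dvd hα0 2 P hP0 hPα
    have hmem : ∀ j ∈ s, j ∈ lowerFace w (-(v : ℝ)) := fun j hj => (Finset.mem_filter.1 hj).2
    obtain ⟨j, hj⟩ := exists_isMarkedPoint hmem hcard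
    have hcell : lowerFace w (-(v : ℝ)) ∈ markedCells w := by
      refine ⟨⟨?_, _, rfl⟩, j, hj⟩
      obtain ⟨hjσ, i, hi, -, -, hij, -⟩ := hj
      exact ⟨i, hi, j, hjσ, hij.ne⟩
    rw [hmarked] at hcell
    exact hcell
  have hPs : P.support = {(i₁ : ℕ), (i₂ : ℕ), (i₃ : ℕ)} := by
    ext m
    rw [hsupp, hface]
    simp [eq_comm]
  have hpow := div_pow_gcd_eq_one h₁₂ h₂₃ hPs hα0 hβ0 hPα hPβ
  have hpos : 0 < Nat.gcd ((i₂ : ℕ) - i₁) ((i₃ : ℕ) - i₁) :=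
    Nat.gcd_pos_of_pos_left _ (Nat.sub_pos_of_lt h₁₂)
  refine ⟨fun h1 => ?_, isOfFinOrder_iff_pow_eq_one.2 ⟨_, hpos, hpow⟩,
    orderOf_dvd_of_pow_eq_one hpow⟩
  rw [div_eq_one_iff_eq hα0] at h1
  -- If `β = α`, the reduction has a root of multiplicity four but only three terms.
  rw [h1, ← pow_add] at hdvd
  have h4 := lt_card_support_of_pow_dvd hα0 _ P hP0 hdvd
  rw [hPs] at h4
  have h3 := Finset.card_le_three (a := (i₁ : ℕ)) (b := (i₂ : ℕ)) (c := (i₃ : ℕ))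
  omega
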